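/- Let $\Omega\subset\mathbb R^3$ be a bounded domain and let $W^0\to W^1\to W^2\to W^3$ be its complex $L^2$ de Rham complex in vector proxies, $W^0=W^3=L^2(\Omega;\mathbb C)$, $W^1=W^2=L^2(\Omega;\mathbb C^3)$, with $d=\nabla,\ \nabla\times,\ \nabla\cdot$ in the sense of distributions. Let $V^0\to V^1\to V^2\to V^3=W^3$ be a dense closed subcomplex: each $V^k\subset W^k$ is a dense subspace on which $d$ is defined with values in $V^{k+1}$, and $(d,V^k)$ is a closed operator. (The choice of the $V^k$ encodes the boundary conditions.) Let $V_k^*\subset W^k$ be the domain of the Hilbert space adjoint $d^*$ of $(d,V^{k-1})$, and assume the compactness property: for each $k$ the inclusion $V^k\cap V_k^*\to W^k$ is compact, where $V^k\cap V^*_k$ has the norm $\|v\|+\|dv\|+\|d^*v\|$ (with $d=0$ on $V^3$ and $d^*=0$ on $V_0^*=W^0$). Let $\mathfrak H^3:=(dV^2)^{\perp}\subset W^3$ be the space of harmonic $3$-forms. Let $\nu>0$, $\lambda>0$, let $l_3:W^1\to W^2$ and $l_5:W^2\to W^2$ be bounded linear maps, and let $\langle a,b\rangle=\int_\Omega a\cdot\bar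 b$. Define $$\overline{L_\lambda}:\ (V^2\cap V_2^*)\times(V_3^*\cap\mathfrak H^{3\perp})\ \to\ \big(V_2^*\times(W^3\cap\mathfrak H^{3\perp})\big)',$$ $$\overline{L_\lambda}(u,p)(v,q):=\langle\nu d^*u,d^*v\rangle+\langle l_3d^*u+l_5u-\lambda d^*p,v\rangle+\langle\lambda\,du,q\rangle ,$$ where $V_2^*$ and $V_3^*$ have the norms $\|v\|+\|d^*v\|$, and $'$ denotes the space of bounded antilinear functionals. Write $\langle\cdot,\cdot\rangle$ also for the map $(u,p)\mapsto\big((v,q)\mapsto\langle u,v\rangle+\langle p,q\rangle\big)$ between the same spaces. Then there is an at most countable set $S\subset\mathbb C$ such that for every $\gamma\in\mathbb C\setminus S$ the operator $\overline{L_\lambda}+\gamma\langle\cdot,\cdot\rangle$ is a bounded isomorphism (a bounded linear bijection with bounded inverse) from $(V^2\cap V_2^*)\times(V_3^*\cap\mathfrak H^{3\perp})$ onto $\big(V_2^*\times(W^3\cap\mathfrak H^{3\perp})\big)'$. -/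

import Mathlib

open MeasureTheory
open scoped ContDiff

noncomputable section

namespace FluidComplex

/-! ### The `L²` spaces on a domain of `ℝ³` and weak vector calculus -/

/-- Three-dimensional Euclidean space. -/
abbrev E3 : Type := EuclideanSpace ℝ (Fin 3)

/-- `L²(Ω; ℂ)`, the space `W⁰ = W³` of (proxies of) square integrable `0`- and `3`-forms. -/
abbrev L2S (Ω : Set E3) : Type := Lp ℂ 2 (volume.restrict Ω)

/-- `L²(Ω; ℂ³)`, the space `W¹ = W²` of (proxies of) square integrable `1`- and `2`-forms. -/
abbrev L2V (Ω : Set E3) : Type := Lp (EuclideanSpace ℂ (Fin 3)) 2 (volume.restrict Ω)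

/-- Smooth real functions with compact support in `Ω`. -/
def IsTest (Ω : Set E3) (φ : E3 → ℝ) : Prop :=
  ContDiff ℝ ∞ φ ∧ HasCompactSupport φ ∧ tsupport φ ⊆ Ω

/-- The partial derivative `∂ᵢ φ`. -/
def pd (i : Fin 3) (φ : E3 → ℝ) (x : E3) : ℝ := fderiv ℝ φ x (EuclideanSpace.single i 1)

/-- `g = ∇ u` in the sense of distributions on `Ω`. -/
def HasWeakGrad {Ω : Set E3} (u : L2S Ω) (g : L2V Ω) : Prop :=
  ∀ φ : E3 → ℝ, IsTest Ω φ → ∀ i : Fin 3,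
    ∫ x in Ω, (φ x : ℂ) * g x i = -∫ x in Ω, (pd i φ x : ℂ) * u x

/-- `c = ∇ × w` in the sense of distributions on `Ω`; indices are taken modulo `3`, so that
`cᵢ = ∂ᵢ₊₁ wᵢ₊₂ - ∂ᵢ₊₂ wᵢ₊₁`. -/
def HasWeakCurl {Ω : Set E3} (w c : L2V Ω) : Prop :=
  ∀ φ : E3 → ℝ, IsTest Ω φ → ∀ i : Fin 3,
    ∫ x in Ω, (φ x : ℂ) * c x i =
      -∫ x in Ω, ((pd (i + 1) φ x : ℂ) * w x (i + 2) - (pd (i + 2) φ x : ℂ) * w x (i + 1))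

/-- `s = ∇ · w` in the sense of distributions on `Ω`. -/
def HasWeakDiv {Ω : Set E3} (w : L2V Ω) (s : L2S Ω) : Prop :=
  ∀ φ : E3 → ℝ, IsTest Ω φ →
    ∫ x in Ω, (φ x : ℂ) * s x = -∫ x in Ω, ∑ i : Fin 3, (pd i φ x : ℂ) * w x i

/-! ### Intersections of operator domains with their graph norm -/

section DomInter

variable {H F G : Type*} [NormedAddCommGroup H] [InnerProductSpace ℂ H]
  [NormedAddCommGroup F] [InnerProductSpace ℂ F]
  [NormedAddCommGroup G] [InnerProductSpace ℂ G]

/-- The intersection `dom S ∩ dom T` of the domains of two unbounded operators, to be normed by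
`‖x‖ + ‖S x‖ + ‖T x‖`. -/
def DomInter (S : H →ₗ.[ℂ] F) (T : H →ₗ.[ℂ] G) : Type _ :=
  ↥(S.domain ⊓ T.domain)

namespace DomInter

variable (S : H →ₗ.[ℂ] F) (T : H →ₗ.[ℂ] G)

instance : AddCommGroup (DomInter S T) :=
  inferInstanceAs (AddCommGroup ↥(S.domain ⊓ T.domain))

instance : Module ℂ (DomInter S T) :=
  inferInstanceAs (Module ℂ ↥(S.domain ⊓ T.domain))

/-- The inclusion into the ambient space, as a linear map. -/
def inclₗ : DomInter S T →ₗ[ℂ] H := (S.domain ⊓ T.domain).subtype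

/-- `x ↦ S x`, as a linear map. -/
def fstₗ : DomInter S T →ₗ[ℂ] F := S.toFun ∘ₗ Submodule.inclusion inf_le_left

/-- `x ↦ T x`, as a linear map. -/
def sndₗ : DomInter S T →ₗ[ℂ] G := T.toFun ∘ₗ Submodule.inclusion inf_le_right

instance : Norm (DomInter S T) := ⟨fun x => ‖inclₗ S T x‖ + ‖fstₗ S T x‖ + ‖sndₗ S T x‖⟩

theorem norm_def (x : DomInter S T) :
    ‖x‖ = ‖inclₗ S T x‖ + ‖fstₗ S T x‖ + ‖sndₗ S T x‖ := rfl

theorem core : NormedSpace.Core ℂ (DomInter S T) where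
  norm_nonneg x := by rw [norm_def]; positivity
  norm_smul c x := by simp only [norm_def, map_smul, norm_smul]; ring
  norm_triangle x y := by
    simp only [norm_def, map_add]
    linarith [norm_add_le (inclₗ S T x) (inclₗ S T y), norm_add_le (fstₗ S T x) (fstₗ S T y),
      norm_add_le (sndₗ S T x) (sndₗ S T y)]
  norm_eq_zero_iff x := by
    constructor
    · intro h
      rw [norm_def] at h
      have h0 : ‖inclₗ S T x‖ = 0 := by
        linarith [norm_nonneg (inclₗ S T x), norm_nonneg (fstₗ S T x), norm_nonneg (sndₗ S T x)]
      exact Subtype.ext (norm_eq_zero.mp h0)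
    · rintro rfl
      simp [norm_def]

instance : NormedAddCommGroup (DomInter S T) := NormedAddCommGroup.ofCore (core S T)

instance : NormedSpace ℂ (DomInter S T) := NormedSpace.ofCore (core S T)

/-- The bounded inclusion `x ↦ x` into the ambient space. -/
def incl : DomInter S T →L[ℂ] H :=
  (inclₗ S T).mkContinuous 1 fun x => by
    rw [norm_def]; linarith [norm_nonneg (fstₗ S T x), norm_nonneg (sndₗ S T x)]

/-- The bounded operator `x ↦ S x`. -/
def fst : DomInter S T →L[ℂ] F :=
  (fstₗ S T).mkContinuous 1 fun x => by
    rw [norm_def]; linarith [norm_nonneg (inclₗ S T x), norm_nonneg (sndₗ S T x)]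

/-- The bounded operator `x ↦ T x`. -/
def snd : DomInter S T →L[ℂ] G :=
  (sndₗ S T).mkContinuous 1 fun x => by
    rw [norm_def]; linarith [norm_nonneg (inclₗ S T x), norm_nonneg (fstₗ S T x)]

end DomInter

end DomInter

/-! ### Domain complexes inside the `L²` de Rham complex -/

/-- A dense closed subcomplex `V⁰ → V¹ → V² → V³` of the `L²` de Rham complex of `Ω`:
`Vᵏ` is the domain of `dᵏ`, a closed densely defined restriction of the weak gradient, curl,
divergence respectively (so that `Vᵏ` is complete for the norm `‖v‖ + ‖d v‖`), `d` maps `Vᵏ` into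
`Vᵏ⁺¹`, `V³ = L²(Ω)` and `d³ = 0`.
The choice of the domains encodes the boundary conditions. -/
structure DeRham (Ω : Set E3) where
  /-- the gradient with domain `V⁰` -/
  d0 : L2S Ω →ₗ.[ℂ] L2V Ω
  /-- the curl with domain `V¹` -/
  d1 : L2V Ω →ₗ.[ℂ] L2V Ω
  /-- the divergence with domain `V²` -/
  d2 : L2V Ω →ₗ.[ℂ] L2S Ω
  d0_grad : ∀ u : d0.domain, HasWeakGrad (u : L2S Ω) (d0 u)
  d1_curl : ∀ u : d1.domain, HasWeakCurl (u : L2V Ω) (d1 u)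
  d2_div : ∀ u : d2.domain, HasWeakDiv (u : L2V Ω) (d2 u)
  d0_dense : Dense (d0.domain : Set (L2S Ω))
  d1_dense : Dense (d1.domain : Set (L2V Ω))
  d2_dense : Dense (d2.domain : Set (L2V Ω))
  d0_closed : d0.IsClosed
  d1_closed : d1.IsClosed
  d2_closed : d2.IsClosed
  d0_mem : ∀ u : d0.domain, d0 u ∈ d1.domain
  d1_mem : ∀ u : d1.domain, d1 u ∈ d2.domain

namespace DeRham

variable {Ω : Set E3} (C : DeRham Ω)

/-- The codifferential `d* : V₁* ⊆ W¹ → W⁰`, adjoint of `(d, V⁰)`. -/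
def dstar1 : L2V Ω →ₗ.[ℂ] L2S Ω := C.d0.adjoint

/-- The codifferential `d* : V₂* ⊆ W² → W¹`, adjoint of `(d, V¹)`. -/
def dstar2 : L2V Ω →ₗ.[ℂ] L2V Ω := C.d1.adjoint

/-- The codifferential `d* : V₃* ⊆ W³ → W²`, adjoint of `(d, V²)`. -/
def dstar3 : L2S Ω →ₗ.[ℂ] L2V Ω := C.d2.adjoint

/-- The everywhere defined zero operator: the differential leaving degree `3` and the
codifferential leaving degree `0`. -/
abbrev zeroOp (H : Type*) [NormedAddCommGroup H] [InnerProductSpace ℂ H] : H →ₗ.[ℂ] ℂ := 0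

/-- The compactness property: the inclusion `Vᵏ ∩ Vₖ* → Wᵏ` is compact for `k = 0, 1, 2, 3`. -/
structure CompactnessProperty : Prop where
  deg0 : IsCompactOperator (DomInter.incl C.d0 (zeroOp (L2S Ω)))
  deg1 : IsCompactOperator (DomInter.incl C.d1 C.dstar1)
  deg2 : IsCompactOperator (DomInter.incl C.d2 C.dstar2)
  deg3 : IsCompactOperator (DomInter.incl (zeroOp (L2S Ω)) C.dstar3)

/-- `𝔅³ = d V²`. -/
def boundaries3 : Submodule ℂ (L2S Ω) := LinearMap.range C.d2.toFun

/-- The harmonic `3`-forms `ℌ³ = ℨ³ ∩ (𝔅³)^⊥`, where `ℨ³ = V³ = L²(Ω)` because `d³ = 0`. -/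
def harmonic3 : Submodule ℂ (L2S Ω) := C.boundaries3ᗮ

/-- `V² ∩ V₂*`, with norm `‖u‖ + ‖d u‖ + ‖d* u‖`. -/
abbrev V2V2star : Type := DomInter C.d2 C.dstar2

/-- `V₂*`, with norm `‖v‖ + ‖d* v‖`. -/
abbrev V2star : Type := DomInter (zeroOp (L2V Ω)) C.dstar2

/-- `V₃*`, with norm `‖p‖ + ‖d* p‖`. -/
abbrev V3star : Type := DomInter (zeroOp (L2S Ω)) C.dstar3

/-- `V₃* ∩ (ℌ³)^⊥` as a subspace of `V₃*`. -/
def V3starPerp : Submodule ℂ C.V3star :=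
  C.harmonic3ᗮ.comap (DomInter.inclₗ (zeroOp (L2S Ω)) C.dstar3)

/-- `W³ ∩ (ℌ³)^⊥`. -/
abbrev W3Perp : Submodule ℂ (L2S Ω) := C.harmonic3ᗮ

/-- The space `(V² ∩ V₂*) × (V₃* ∩ (ℌ³)^⊥)` of trial functions `(u, p)`. -/
abbrev Trial : Type := C.V2V2star × ↥C.V3starPerp

/-- The space `V₂* × (W³ ∩ (ℌ³)^⊥)` of test functions `(v, q)`. -/
abbrev TestSpace : Type := C.V2star × ↥C.W3Perp

/-- The dual `(V₂* × (W³ ∩ (ℌ³)^⊥))'`: the bounded antilinear functionals of `(v, q)`, the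
Hermitian pairing `⟨a, b⟩ = ∫ a · conj b` being linear in `a` and antilinear in `b`. -/
abbrev TestDual : Type := C.TestSpace →L⋆[ℂ] ℂ

end DeRham

/-! ### The operators -/

section Pairing

variable {X Y H : Type*} [NormedAddCommGroup X] [NormedSpace ℂ X]
  [NormedAddCommGroup Y] [NormedSpace ℂ Y] [NormedAddCommGroup H] [InnerProductSpace ℂ H]

/-- For bounded `A : X → H` and `B : Y → H`, the bounded operator `X → Y'`,
`x ↦ (y ↦ ⟨A x, B y⟩)`, linear in `x` and antilinear in `y` (Mathlib's `inner ℂ a b` is antilinear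
in `a`). -/
def pairing (A : X →L[ℂ] H) (B : Y →L[ℂ] H) : X →L[ℂ] (Y →L⋆[ℂ] ℂ) :=
  LinearMap.mkContinuous₂
    (LinearMap.mk₂'ₛₗ (RingHom.id ℂ) (starRingEnd ℂ) (fun x y => inner ℂ (B y) (A x))
      (fun x x' y => by simp)
      (fun c x y => by simp)
      (fun x y y' => by simp)
      (fun c x y => by simp [mul_comm]))
    (‖A‖ * ‖B‖)
    (fun x y => by
      calc ‖inner ℂ (B y) (A x)‖ ≤ ‖B y‖ * ‖A x‖ := norm_inner_le_norm _ _
        _ ≤ (‖B‖ * ‖y‖) * (‖A‖ * ‖x‖) := by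
            gcongr
            · exact B.le_opNorm y
            · exact A.le_opNorm x
        _ = ‖A‖ * ‖B‖ * ‖x‖ * ‖y‖ := by ring)

theorem pairing_apply (A : X →L[ℂ] H) (B : Y →L[ℂ] H) (x : X) (y : Y) :
    pairing A B x y = inner ℂ (B y) (A x) := rfl

end Pairing

namespace DeRham

variable {Ω : Set E3} (C : DeRham Ω)

/-- `(u, p) ↦ u`. -/
def trialU : C.Trial →L[ℂ] L2V Ω :=
  DomInter.incl C.d2 C.dstar2 ∘L ContinuousLinearMap.fst ℂ C.V2V2star C.V3starPerp

/-- `(u, p) ↦ d u`. -/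
def trialDU : C.Trial →L[ℂ] L2S Ω :=
  DomInter.fst C.d2 C.dstar2 ∘L ContinuousLinearMap.fst ℂ C.V2V2star C.V3starPerp

/-- `(u, p) ↦ d* u`. -/
def trialDstarU : C.Trial →L[ℂ] L2V Ω :=
  DomInter.snd C.d2 C.dstar2 ∘L ContinuousLinearMap.fst ℂ C.V2V2star C.V3starPerp

/-- `(u, p) ↦ p`. -/
def trialP : C.Trial →L[ℂ] L2S Ω :=
  DomInter.incl (zeroOp (L2S Ω)) C.dstar3 ∘L C.V3starPerp.subtypeL ∘L
    ContinuousLinearMap.snd ℂ C.V2V2star C.V3starPerp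

/-- `(u, p) ↦ d* p`. -/
def trialDstarP : C.Trial →L[ℂ] L2V Ω :=
  DomInter.snd (zeroOp (L2S Ω)) C.dstar3 ∘L C.V3starPerp.subtypeL ∘L
    ContinuousLinearMap.snd ℂ C.V2V2star C.V3starPerp

/-- `(v, q) ↦ v`. -/
def testV : C.TestSpace →L[ℂ] L2V Ω :=
  DomInter.incl (zeroOp (L2V Ω)) C.dstar2 ∘L ContinuousLinearMap.fst ℂ C.V2star C.W3Perp

/-- `(v, q) ↦ d* v`. -/
def testDstarV : C.TestSpace →L[ℂ] L2V Ω :=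
  DomInter.snd (zeroOp (L2V Ω)) C.dstar2 ∘L ContinuousLinearMap.fst ℂ C.V2star C.W3Perp

/-- `(v, q) ↦ q`. -/
def testQ : C.TestSpace →L[ℂ] L2S Ω :=
  C.W3Perp.subtypeL ∘L ContinuousLinearMap.snd ℂ C.V2star C.W3Perp

/-- The extended primal operator
`L̄_lam (u, p) (v, q) = ⟨ν d* u, d* v⟩ + ⟨l₃ d* u + l₅ u - lam d* p, v⟩ + ⟨lam d u, q⟩`. -/
def Lbar (ν lam : ℝ) (l3 l5 : L2V Ω →L[ℂ] L2V Ω) : C.Trial →L[ℂ] C.TestDual :=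
  pairing ((ν : ℂ) • C.trialDstarU) C.testDstarV
    + pairing (l3 ∘L C.trialDstarU + l5 ∘L C.trialU - (lam : ℂ) • C.trialDstarP) C.testV
    + pairing ((lam : ℂ) • C.trialDU) C.testQ

/-- The operator `⟨·, ·⟩ : (u, p) ↦ ((v, q) ↦ ⟨u, v⟩ + ⟨p, q⟩)`. -/
def innerOp : C.Trial →L[ℂ] C.TestDual :=
  pairing C.trialU C.testV + pairing C.trialP C.testQ

end DeRham

end FluidComplex

end

/-! The operator is invertible at one large real `γ₀`, and varying `γ` adds a multiple of a compact
operator. Hence `A + γ K = e (1 + (γ - γ₀) T)` with `e = A + γ₀ K` an isomorphism and `T = e⁻¹ K`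
compact. By the Fredholm alternative the exceptional `γ` come from nonzero eigenvalues of `T`, and
there are at most countably many (`countable_setOf_not_isInvertible_add_smul`).

For invertibility at real `γ` (`exists_saddlePoint`, `saddlePoint_unique`), the `q`-equation `lam d
u + γ p = g` gives `p = γ⁻¹ (g - lam d u)`. Substituting this and testing only with `v ∈ V² ∩ V₂*`
replaces the pressure term by `(lam² / γ) ⟨d u, d v⟩`. The resulting form is coercive on `V² ∩ V₂*`
for large `γ`, so Lax–Milgram yields `u`.

It remains to recover `p ∈ V₃*` and the equation for all `v ∈ V₂*`. Since `d ∘ d = 0`, `(ker d)^⊥ ⊆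
ker d*`; hence projecting `x ∈ V²` onto `(ker d)^⊥` keeps `d x`, kills `d*`, and is bounded in the
`L²` norm. Testing with such projections bounds `⟨p, d x⟩` by `‖x‖`, which is membership in `V₃*`.
The same projection, with the density of `V²`, extends the equation to `V₂*`. -/

/-! ### Eigenvalues of compact operators -/

section CompactSpectrum

open Module.End Filter Topology

namespace IsCompactOperator

variable {𝕜 X : Type*} [NontriviallyNormedField 𝕜] [CompleteSpace 𝕜]
  [NormedAddCommGroup X] [NormedSpace 𝕜 X] {T : X →L[𝕜] X}

/-- A compact operator has only finitely many eigenvalues outside a ball around the origin. -/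
theorem finite_setOf_hasEigenvalue_le_norm (hT : IsCompactOperator T) {ε : ℝ} (hε : 0 < ε) :
    {μ : 𝕜 | HasEigenvalue (T : Module.End 𝕜 X) μ ∧ ε ≤ ‖μ‖}.Finite := by
  by_contra hinf
  let μ : ℕ ↪ {μ : 𝕜 | HasEigenvalue (T : Module.End 𝕜 X) μ ∧ ε ≤ ‖μ‖} :=
    Set.Infinite.natEmbedding _ hinf
  have hμ_inj : Function.Injective fun n => (μ n : 𝕜) :=
    Subtype.val_injective.comp μ.injective
  choose v hv using fun n => (μ n).2.1.exists_hasEigenvector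
  have hTv : ∀ n, T (v n) = (μ n : 𝕜) • v n := fun n => (hv n).apply_eq_smul
  have hli : LinearIndependent 𝕜 v := eigenvectors_linearIndependent' _ _ hμ_inj v hv
  let M (n : ℕ) : Submodule 𝕜 X := Submodule.span 𝕜 (v '' Set.Iio n)
  have hM_mono : Monotone M := fun m n h =>
    Submodule.span_mono (Set.image_mono (Set.Iio_subset_Iio h))
  have hvM {i n : ℕ} (h : i < n) : v i ∈ M n := Submodule.subset_span ⟨i, h, rfl⟩
  have hvM' (n : ℕ) : v n ∉ M n := hli.notMem_span_image (by simp)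
  have hM_closed (n : ℕ) : IsClosed (M n : Set X) := by
    have : FiniteDimensional 𝕜 (M n) :=
      FiniteDimensional.span_of_finite 𝕜 ((Set.finite_Iio n).image v)
    exact (M n).closed_of_finiteDimensional
  have hTM (n : ℕ) {y : X} (hy : y ∈ M n) : T y ∈ M n := by
    have : M n ≤ (M n).comap (T : X →ₗ[𝕜] X) := by
      refine Submodule.span_le.2 ?_
      rintro _ ⟨i, hi, rfl⟩
      simpa [hTv] using Submodule.smul_mem _ _ (hvM hi)
    exact this hy
  -- `T - μₙ` kills `vₙ` and preserves the span of the earlier eigenvectors, so it lowers the flag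
  -- by one step.
  have hTM' (n : ℕ) {y : X} (hy : y ∈ M (n + 1)) : T y - (μ n : 𝕜) • y ∈ M n := by
    have : M (n + 1) ≤ (M n).comap ((T : X →ₗ[𝕜] X) - (μ n : 𝕜) • LinearMap.id) := by
      refine Submodule.span_le.2 ?_
      rintro _ ⟨i, hi, rfl⟩
      rcases (Nat.lt_succ_iff_lt_or_eq.1 hi) with h | rfl
      · simpa [hTv, ← sub_smul] using Submodule.smul_mem _ _ (hvM h)
      · simp [hTv]
    exact this hy
  obtain ⟨c, hc⟩ := NormedField.exists_one_lt_norm 𝕜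
  -- Riesz's lemma. Vectors cannot be normalised exactly over a general `𝕜`, so the bound is any
  -- number above `‖c‖`, where `1 < ‖c‖`.
  have hy (n : ℕ) : ∃ y ∈ M (n + 1), ‖y‖ ≤ ‖c‖ + 1 ∧ ∀ z ∈ M n, 1 ≤ ‖y - z‖ := by
    have h₁ : IsClosed ((M n).comap (M (n + 1)).subtype : Set (M (n + 1))) :=
      (hM_closed n).preimage continuous_subtype_val
    have h₂ : ∃ x : M (n + 1), x ∉ (M n).comap (M (n + 1)).subtype :=
      ⟨⟨v n, hvM n.lt_succ_self⟩, hvM' n⟩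
    obtain ⟨⟨y, hyM⟩, hyn, hyd⟩ := riesz_lemma_of_norm_lt hc (lt_add_one ‖c‖) h₁ h₂
    exact ⟨y, hyM, hyn, fun z hz => hyd ⟨z, hM_mono n.le_succ hz⟩ hz⟩
  choose y hyM hyn hyd using hy
  -- `T yₙ - T yₘ = μₙ (yₙ - z)` with `z ∈ M n`, so the images of a bounded sequence stay `ε` apart,
  -- against compactness.
  have hsep {m n : ℕ} (hmn : m < n) : ε ≤ ‖T (y n) - T (y m)‖ := by
    have hμ0 : (μ n : 𝕜) ≠ 0 := norm_pos_iff.1 (hε.trans_le (μ n).2.2)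
    let z : X := (μ n : 𝕜)⁻¹ • (T (y m) - (T (y n) - (μ n : 𝕜) • y n))
    have hz : z ∈ M n := Submodule.smul_mem _ _
      (Submodule.sub_mem _ (hTM n (hM_mono (Nat.succ_le_of_lt hmn) (hyM m))) (hTM' n (hyM n)))
    have hTz : (μ n : 𝕜) • (y n - z) = T (y n) - T (y m) := by
      rw [smul_sub, smul_inv_smul₀ hμ0]; abel
    rw [← hTz, norm_smul]
    calc ε ≤ ‖(μ n : 𝕜)‖ := (μ n).2.2
      _ ≤ ‖(μ n : 𝕜)‖ * ‖y n - z‖ := le_mul_of_one_le_right (norm_nonneg _) (hyd n z hz)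
  obtain ⟨K, hK, hK'⟩ := hT.image_closedBall_subset_compact (‖c‖ + 1)
  obtain ⟨x, -, ψ, hψ, hψx⟩ := hK.tendsto_subseq (fun n => hK' ⟨y n, by simp [hyn n], rfl⟩)
  obtain ⟨N, hN⟩ := Metric.cauchySeq_iff'.1 hψx.cauchySeq ε hε
  have h := hN (N + 1) N.le_succ
  rw [dist_eq_norm] at h
  exact (hsep (hψ N.lt_succ_self)).not_gt h

/-- A compact operator has at most countably many eigenvalues. -/
theorem countable_setOf_hasEigenvalue (hT : IsCompactOperator T) :
    {μ : 𝕜 | HasEigenvalue (T : Module.End 𝕜 X) μ}.Countable := by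
  have hsub : {μ : 𝕜 | HasEigenvalue (T : Module.End 𝕜 X) μ} ⊆
      insert 0 (⋃ n : ℕ, {μ : 𝕜 | HasEigenvalue (T : Module.End 𝕜 X) μ ∧
        1 / ((n : ℝ) + 1) ≤ ‖μ‖}) := by
    intro μ hμ
    rcases eq_or_ne μ 0 with rfl | h0
    · exact Set.mem_insert _ _
    · obtain ⟨n, hn⟩ := exists_nat_one_div_lt (norm_pos_iff.2 h0)
      exact Set.mem_insert_of_mem _ (Set.mem_iUnion.2 ⟨n, hμ, hn.le⟩)
  refine Set.Countable.mono hsub (Set.Countable.insert _ (Set.countable_iUnion fun n => ?_))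
  exact (hT.finite_setOf_hasEigenvalue_le_norm (by positivity)).countable

/-- If `A + γ K` is invertible for one `γ` and `K` is compact, then it is invertible for all but
countably many `γ`. -/
theorem countable_setOf_not_isInvertible_add_smul [CompleteSpace X]
    {Y : Type*} [NormedAddCommGroup Y] [NormedSpace 𝕜 Y] {A K : X →L[𝕜] Y}
    (hK : IsCompactOperator K) {γ₀ : 𝕜} (h₀ : (A + γ₀ • K).IsInvertible) :
    {γ : 𝕜 | ¬ (A + γ • K).IsInvertible}.Countable := by
  obtain ⟨e, he⟩ := h₀
  let T : X →L[𝕜] X := (e.symm : Y →L[𝕜] X) ∘L K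
  have hT : IsCompactOperator T := hK.clm_comp (e.symm : Y →L[𝕜] X)
  have hfact (γ : 𝕜) : A + γ • K = (e : X →L[𝕜] Y) ∘L (1 + (γ - γ₀) • T) := by
    have hA : A = (e : X →L[𝕜] Y) - γ₀ • K := by rw [he]; abel
    ext x
    simp only [hA, T, sub_smul, add_apply, sub_apply,
      smul_apply, ContinuousLinearMap.comp_apply,
      ContinuousLinearEquiv.coe_coe, one_apply_eq_self, map_add, map_sub, map_smul,
      ContinuousLinearEquiv.apply_symm_apply]
    abel
  -- `1 + (γ - γ₀) T` can fail to be invertible only if `μ = -(γ - γ₀)⁻¹` is an eigenvalue of `T`;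
  -- solving for `γ` gives `γ₀ - μ⁻¹`.
  refine ((hT.countable_setOf_hasEigenvalue).image fun μ => γ₀ - μ⁻¹).mono fun γ hγ => ?_
  have hne : γ ≠ γ₀ := by
    rintro rfl
    exact hγ ⟨e, he⟩
  have hne' : γ - γ₀ ≠ 0 := sub_ne_zero.2 hne
  have hμ : -(γ - γ₀)⁻¹ ≠ 0 := neg_ne_zero.2 (inv_ne_zero hne')
  refine ⟨-(γ - γ₀)⁻¹, ?_, by simp [inv_neg]⟩
  refine (hT.hasEigenvalue_or_mem_resolventSet hμ).resolve_right fun hres => hγ ?_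
  have hunit : IsUnit (1 + (γ - γ₀) • T) := by
    rw [spectrum.mem_resolventSet_iff] at hres
    have h1 : (1 + (γ - γ₀) • T) =
        (-(γ - γ₀)) • (algebraMap 𝕜 (X →L[𝕜] X) (-(γ - γ₀)⁻¹) - T) := by
      rw [smul_sub, Algebra.algebraMap_eq_smul_one, smul_smul, neg_mul_neg,
        mul_inv_cancel₀ hne', one_smul, neg_smul, sub_neg_eq_add]
    rw [h1]
    exact hres.smul (Units.mk0 _ (neg_ne_zero.2 hne'))
  obtain ⟨w, hw⟩ := hunit
  refine ⟨(ContinuousLinearEquiv.unitsEquiv 𝕜 X w).trans e, ?_⟩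
  rw [hfact, ← hw]
  rfl

end IsCompactOperator

end CompactSpectrum

/-! ### The complex Lax–Milgram theorem -/

section LaxMilgram

/-- The **Lax–Milgram theorem** for a bounded coercive sesquilinear form on a complex Hilbert
space. -/
theorem exists_eq_of_coercive_sesq {H : Type*} [NormedAddCommGroup H] [InnerProductSpace ℂ H]
    [CompleteSpace H] (a : H →L[ℂ] H →L⋆[ℂ] ℂ) {c : ℝ} (hc : 0 < c)
    (ha : ∀ u, c * ‖u‖ ^ 2 ≤ (a u u).re) (f : H →L⋆[ℂ] ℂ) : ∃ u, a u = f := by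
  -- The real Lax–Milgram theorem is applied to `Re a` on the underlying real Hilbert space.
  let _ : InnerProductSpace ℝ H := InnerProductSpace.rclikeToReal ℂ H
  let B : H →L[ℝ] H →L[ℝ] ℝ := LinearMap.mkContinuous₂
    (LinearMap.mk₂ ℝ (fun u v => (a u v).re) (fun u u' v => by simp) (fun r u v => by
        rw [← Complex.coe_smul, map_smul]; simp)
      (fun u v v' => by simp) (fun r u v => by
        rw [← Complex.coe_smul, map_smulₛₗ]; simp)) ‖a‖
    (fun u v => (Complex.abs_re_le_norm _).trans (a.le_opNorm₂ u v))
  have hB : ∀ u v, B u v = (a u v).re := fun u v => rfl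
  have hcoer : IsCoercive B := ⟨c, hc, fun u => by
    rw [hB, mul_assoc, ← sq]
    exact ha u⟩
  let F : StrongDual ℝ H := LinearMap.mkContinuous
    { toFun := fun v => (f v).re
      map_add' := fun v w => by simp
      map_smul' := fun r v => by rw [← Complex.coe_smul, map_smulₛₗ]; simp } ‖f‖
    (fun v => (Complex.abs_re_le_norm _).trans (f.le_opNorm v))
  have hF : ∀ v, F v = (f v).re := fun v => rfl
  let w : H := (InnerProductSpace.toDual ℝ H).symm F
  obtain ⟨u, hu⟩ := hcoer.continuousLinearEquivOfBilin.surjective w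
  have hre : ∀ v, (a u v).re = (f v).re := fun v => by
    rw [← hB, ← hF, ← hcoer.continuousLinearEquivOfBilin_apply, hu,
      InnerProductSpace.toDual_symm_apply]
  refine ⟨u, ContinuousLinearMap.ext fun v => Complex.ext (hre v) ?_⟩
  -- By antilinearity in `v`, testing with `i v` turns equality of real parts into equality of
  -- imaginary parts.
  have h := hre (Complex.I • v)
  rw [map_smulₛₗ, map_smulₛₗ] at h
  simpa using h

open Topology in
/-- The Lax–Milgram theorem for a bounded coercive sesquilinear form on a normed space which
embeds as a closed subspace of a complex Hilbert space. -/
theorem exists_eq_of_coercive_sesq_of_isClosedEmbedding {X H : Type*} [NormedAddCommGroup X]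
    [NormedSpace ℂ X] [CompleteSpace X] [NormedAddCommGroup H] [InnerProductSpace ℂ H]
    [CompleteSpace H]
    (J : X →L[ℂ] H) (hJ : IsClosedEmbedding J) (a : X →L[ℂ] X →L⋆[ℂ] ℂ) {c : ℝ} (hc : 0 < c)
    (ha : ∀ u, c * ‖u‖ ^ 2 ≤ (a u u).re) (f : X →L⋆[ℂ] ℂ) : ∃ u, a u = f := by
  have : CompleteSpace J.range := by
    refine IsClosed.completeSpace_coe (hs := ?_)
    rw [LinearMap.coe_range]
    exact hJ.isClosed_range
  let e : X ≃L[ℂ] J.range := J.equivRange hJ.injective hJ.isClosed_range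
  have heJ : ∀ x, ‖e x‖ ≤ ‖J‖ * ‖x‖ := fun x => J.le_opNorm x
  let E : J.range →L[ℂ] X := (e.symm : J.range →L[ℂ] X)
  let a' : J.range →L[ℂ] J.range →L⋆[ℂ] ℂ := LinearMap.mkContinuous₂
    (LinearMap.mk₂'ₛₗ (RingHom.id ℂ) (starRingEnd ℂ) (fun r s => a (E r) (E s))
      (fun r r' s => by simp) (fun z r s => by simp) (fun r s s' => by simp)
      (fun z r s => by simp)) (‖a‖ * ‖E‖ * ‖E‖)
    (fun r s => by
      calc ‖a (E r) (E s)‖ ≤ ‖a‖ * ‖E r‖ * ‖E s‖ := a.le_opNorm₂ _ _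
        _ ≤ ‖a‖ * (‖E‖ * ‖r‖) * (‖E‖ * ‖s‖) := by
          gcongr
          · exact E.le_opNorm r
          · exact E.le_opNorm s
        _ = ‖a‖ * ‖E‖ * ‖E‖ * ‖r‖ * ‖s‖ := by ring)
  -- The norms of `X` and of `J.range` are only equivalent, which costs `‖J‖²`; the `+ 1` keeps the
  -- denominator positive.
  have ha' : ∀ r, c / (‖J‖ + 1) ^ 2 * ‖r‖ ^ 2 ≤ (a' r r).re := fun r => by
    have h1 : ‖r‖ ≤ (‖J‖ + 1) * ‖E r‖ := by
      have := heJ (E r)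
      rw [show e (E r) = r from e.apply_symm_apply r] at this
      nlinarith [norm_nonneg (E r)]
    have h2 : ‖r‖ ^ 2 ≤ (‖J‖ + 1) ^ 2 * ‖E r‖ ^ 2 := by
      rw [← mul_pow]; gcongr
    calc c / (‖J‖ + 1) ^ 2 * ‖r‖ ^ 2 ≤ c / (‖J‖ + 1) ^ 2 * ((‖J‖ + 1) ^ 2 * ‖E r‖ ^ 2) := by
          gcongr
      _ = c * ‖E r‖ ^ 2 := by field_simp
      _ ≤ (a' r r).re := ha (E r)
  obtain ⟨r, hr⟩ := exists_eq_of_coercive_sesq a' (by positivity) ha' (f.comp E)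
  refine ⟨E r, ContinuousLinearMap.ext fun v => ?_⟩
  have h : a (E r) (E (e v)) = f (E (e v)) := DFunLike.congr_fun hr (e v)
  rwa [show E (e v) = v from e.symm_apply_apply v] at h

end LaxMilgram

/-! ### Intersections of domains of closed operators -/

namespace FluidComplex

namespace DomInter

open Topology

section

variable {H F G : Type*} [NormedAddCommGroup H] [InnerProductSpace ℂ H]
  [NormedAddCommGroup F] [InnerProductSpace ℂ F]
  [NormedAddCommGroup G] [InnerProductSpace ℂ G]
  (S : H →ₗ.[ℂ] F) (T : H →ₗ.[ℂ] G)

theorem norm_eq (x : DomInter S T) : ‖x‖ = ‖incl S T x‖ + ‖fst S T x‖ + ‖snd S T x‖ := rfl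

theorem incl_mem_fst (x : DomInter S T) : incl S T x ∈ S.domain := x.2.1

theorem incl_mem_snd (x : DomInter S T) : incl S T x ∈ T.domain := x.2.2

/-- The element of `dom S ∩ dom T` given by a vector in both domains. -/
noncomputable def mk (x : H) (hS : x ∈ S.domain) (hT : x ∈ T.domain) : DomInter S T := ⟨x, hS, hT⟩

theorem incl_injective : Function.Injective (incl S T) := Subtype.val_injective

/-- The embedding `x ↦ (x, S x, T x)`. -/
noncomputable def graphMap : DomInter S T →L[ℂ] H × F × G :=
  (incl S T).prod ((fst S T).prod (snd S T))

theorem antilipschitzWith_graphMap : AntilipschitzWith 3 (graphMap S T) := by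
  refine ContinuousLinearMap.antilipschitz_of_bound _ fun x => ?_
  have h1 : ‖incl S T x‖ ≤ ‖graphMap S T x‖ := le_max_left _ _
  have h2 : ‖fst S T x‖ ≤ ‖graphMap S T x‖ := (le_max_left _ _).trans (le_max_right _ _)
  have h3 : ‖snd S T x‖ ≤ ‖graphMap S T x‖ := (le_max_right _ _).trans (le_max_right _ _)
  rw [norm_eq]
  push_cast
  linarith

variable {S T}

/-- The range consists of the triples whose two pairs lie in the closed graphs of `S` and `T`. -/
theorem isClosed_range_graphMap (hS : S.IsClosed) (hT : T.IsClosed) :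
    IsClosed (Set.range (graphMap S T)) := by
  have h : Set.range (graphMap S T) =
      (fun z : H × F × G => (z.1, z.2.1)) ⁻¹' (S.graph : Set (H × F)) ∩
      (fun z : H × F × G => (z.1, z.2.2)) ⁻¹' (T.graph : Set (H × G)) := by
    ext ⟨x, y, z⟩
    simp only [Set.mem_range, Set.mem_inter_iff, Set.mem_preimage, SetLike.mem_coe,
      LinearPMap.mem_graph_iff]
    constructor
    · rintro ⟨w, hw⟩
      simp only [graphMap, ContinuousLinearMap.prod_apply, Prod.mk.injEq] at hw
      obtain ⟨rfl, rfl, rfl⟩ := hw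
      exact ⟨⟨⟨_, incl_mem_fst S T w⟩, rfl, rfl⟩, ⟨⟨_, incl_mem_snd S T w⟩, rfl, rfl⟩⟩
    · rintro ⟨⟨⟨a, ha⟩, rfl, rfl⟩, ⟨⟨b, hb⟩, h, rfl⟩⟩
      obtain rfl : b = a := h
      exact ⟨mk S T b ha hb, rfl⟩
  rw [h]
  exact (IsClosed.preimage (by fun_prop) hS).inter (IsClosed.preimage (by fun_prop) hT)

variable [CompleteSpace H] [CompleteSpace F] [CompleteSpace G]

theorem completeSpace (hS : S.IsClosed) (hT : T.IsClosed) : CompleteSpace (DomInter S T) := by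
  rw [completeSpace_iff_isComplete_range
    ((antilipschitzWith_graphMap S T).isUniformInducing (graphMap S T).uniformContinuous)]
  exact (isClosed_range_graphMap hS hT).isComplete

theorem isClosedEmbedding_graphMap (hS : S.IsClosed) (hT : T.IsClosed) :
    IsClosedEmbedding (graphMap S T) := by
  have := completeSpace hS hT
  exact (antilipschitzWith_graphMap S T).isClosedEmbedding (graphMap S T).uniformContinuous

/-- The Lax–Milgram theorem on `dom S ∩ dom T`. -/
theorem exists_eq_of_coercive (hS : S.IsClosed) (hT : T.IsClosed)
    (a : DomInter S T →L[ℂ] DomInter S T →L⋆[ℂ] ℂ) {c : ℝ} (hc : 0 < c)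
    (ha : ∀ u, c * ‖u‖ ^ 2 ≤ (a u u).re) (f : DomInter S T →L⋆[ℂ] ℂ) : ∃ u, a u = f := by
  have := completeSpace hS hT
  -- The sum norm on `dom S ∩ dom T` and the sup norm on the product are not Hilbertian; the `ℓ²`
  -- product is an equivalent Hilbert space.
  let e₁ : (F × G) ≃L[ℂ] WithLp 2 (F × G) := (WithLp.prodContinuousLinearEquiv 2 ℂ F G).symm
  let e : (H × F × G) ≃L[ℂ] WithLp 2 (H × WithLp 2 (F × G)) :=
    ((ContinuousLinearEquiv.refl ℂ H).prodCongr e₁).trans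
      (WithLp.prodContinuousLinearEquiv 2 ℂ H (WithLp 2 (F × G))).symm
  exact exists_eq_of_coercive_sesq_of_isClosedEmbedding
    ((e : (H × F × G) →L[ℂ] WithLp 2 (H × WithLp 2 (F × G))) ∘L graphMap S T)
    (e.toHomeomorph.isClosedEmbedding.comp (isClosedEmbedding_graphMap hS hT)) a hc ha f

end

end DomInter

end FluidComplex

/-! ### A saddle point problem on a closed Hilbert complex -/

namespace FluidComplex

section HilbertComplex

variable {E F G : Type*} [NormedAddCommGroup E] [InnerProductSpace ℂ E]
  [NormedAddCommGroup F] [InnerProductSpace ℂ F]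
  [NormedAddCommGroup G] [InnerProductSpace ℂ G]

/-- The kernel of an unbounded operator. -/
def kernel (S : F →ₗ.[ℂ] G) : Submodule ℂ F := S.graph.comap (LinearMap.inl ℂ F G)

theorem mem_kernel {S : F →ₗ.[ℂ] G} {x : F} : x ∈ kernel S ↔ (x, (0 : G)) ∈ S.graph := Iff.rfl

theorem isClosed_kernel {S : F →ₗ.[ℂ] G} (hS : S.IsClosed) : IsClosed (kernel S : Set F) :=
  IsClosed.preimage (f := fun x : F => (x, (0 : G))) (by fun_prop) hS

theorem isClosed_zero : (0 : F →ₗ.[ℂ] G).IsClosed := by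
  have h : ((0 : F →ₗ.[ℂ] G).graph : Set (F × G)) = {z | z.2 = 0} := by
    ext ⟨x, y⟩
    simp only [SetLike.mem_coe, LinearPMap.mem_graph_iff, Set.mem_ofPred_eq]
    exact ⟨fun ⟨a, _, h⟩ => h.symm, fun h => ⟨⟨x, trivial⟩, rfl, h.symm⟩⟩
  rw [LinearPMap.IsClosed, h]
  exact isClosed_eq continuous_snd continuous_const

/-- As `ran T ⊆ ker S`, the functional `x ↦ ⟨y, T x⟩` vanishes, hence is represented by `0`. -/
theorem mem_adjoint_graph_of_mem_kernel_orthogonal [CompleteSpace E]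
    {T : E →ₗ.[ℂ] F} {S : F →ₗ.[ℂ] G}
    (hT : Dense (T.domain : Set E)) (hST : ∀ x : T.domain, T x ∈ kernel S) {y : F}
    (hy : y ∈ (kernel S)ᗮ) : (y, (0 : E)) ∈ T.adjoint.graph := by
  have h : ∀ x : T.domain, inner ℂ (0 : E) (x : E) = inner ℂ y (T x) := fun x => by
    rw [inner_zero_left, Submodule.inner_left_of_mem_orthogonal (hST x) hy]
  have hmem := LinearPMap.mem_adjoint_domain_of_exists y ⟨0, h⟩
  exact (LinearPMap.mem_graph_iff _).2 ⟨⟨y, hmem⟩, rfl, LinearPMap.adjoint_apply_eq hT _ h⟩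

theorem DomInter.norm_eq_of_zero (T : F →ₗ.[ℂ] E) (x : DomInter (0 : F →ₗ.[ℂ] G) T) :
    ‖x‖ = ‖DomInter.incl _ T x‖ + ‖DomInter.snd _ T x‖ := by
  have h : ‖DomInter.fst _ T x‖ = 0 := norm_zero
  rw [DomInter.norm_eq, h, add_zero]

/-- The inclusion `dom S ∩ dom T → dom T`. -/
noncomputable def DomInter.toSnd (S : F →ₗ.[ℂ] G) (T : F →ₗ.[ℂ] E) :
    DomInter S T →L[ℂ] DomInter (0 : F →ₗ.[ℂ] ℂ) T :=
  LinearMap.mkContinuous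
    { toFun := fun x => DomInter.mk _ _ (DomInter.incl S T x) trivial (DomInter.incl_mem_snd S T x)
      map_add' := fun _ _ => rfl
      map_smul' := fun _ _ => rfl } 1
    (fun x => by
      rw [one_mul, DomInter.norm_eq_of_zero, DomInter.norm_eq]
      exact add_le_add_left (le_add_of_nonneg_right (norm_nonneg _)) _)

theorem DomInter.incl_toSnd (S : F →ₗ.[ℂ] G) (T : F →ₗ.[ℂ] E) (x : DomInter S T) :
    DomInter.incl _ T (DomInter.toSnd S T x) = DomInter.incl S T x := rfl

theorem DomInter.snd_toSnd (S : F →ₗ.[ℂ] G) (T : F →ₗ.[ℂ] E) (x : DomInter S T) :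
    DomInter.snd _ T (DomInter.toSnd S T x) = DomInter.snd S T x := rfl

/-- A subspace on which `T` vanishes, mapped into `dom T`. -/
noncomputable def DomInter.ofKernel (T : F →ₗ.[ℂ] E) (K : Submodule ℂ F) (hK : K ≤ kernel T) :
    K →L[ℂ] DomInter (0 : F →ₗ.[ℂ] ℂ) T :=
  LinearMap.mkContinuous
    { toFun := fun x => DomInter.mk _ _ (x : F) trivial
        (LinearPMap.mem_domain_of_mem_graph (mem_kernel.1 (hK x.2)))
      map_add' := fun _ _ => rfl
      map_smul' := fun _ _ => rfl } 1
    (fun x => by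
      have h0 : T ⟨(x : F), LinearPMap.mem_domain_of_mem_graph (mem_kernel.1 (hK x.2))⟩ = 0 :=
        ((LinearPMap.image_iff _).2 (mem_kernel.1 (hK x.2))).symm
      rw [one_mul, DomInter.norm_eq_of_zero]
      exact (congrArg (‖(x : F)‖ + ‖·‖) h0).le.trans (by simp))

theorem re_inner_real_smul_self (r : ℝ) (x : F) :
    (inner ℂ x ((r : ℂ) • x)).re = r * ‖x‖ ^ 2 := by
  rw [inner_smul_right, inner_self_eq_norm_sq_to_K, Complex.re_ofReal_mul]
  norm_cast

/-! ### The form left after eliminating the pressure -/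

section ReducedForm

variable (S : F →ₗ.[ℂ] G) (T : F →ₗ.[ℂ] E) (ν γ κ : ℝ) (l3 : E →L[ℂ] F) (l5 : F →L[ℂ] F)

/-- The sesquilinear form
`ν ⟨T u, T v⟩ + ⟨l₃ T u + l₅ u + γ u, v⟩ + κ ⟨S u, S v⟩` on `dom S ∩ dom T`. -/
noncomputable def reducedForm : DomInter S T →L[ℂ] DomInter S T →L⋆[ℂ] ℂ :=
  pairing ((ν : ℂ) • DomInter.snd S T) (DomInter.snd S T)
    + pairing (l3 ∘L DomInter.snd S T + l5 ∘L DomInter.incl S T + (γ : ℂ) • DomInter.incl S T)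
      (DomInter.incl S T)
    + pairing ((κ : ℂ) • DomInter.fst S T) (DomInter.fst S T)

theorem reducedForm_apply (u v : DomInter S T) : reducedForm S T ν γ κ l3 l5 u v =
    inner ℂ (DomInter.snd S T v) ((ν : ℂ) • DomInter.snd S T u)
      + inner ℂ (DomInter.incl S T v) (l3 (DomInter.snd S T u) + l5 (DomInter.incl S T u)
        + (γ : ℂ) • DomInter.incl S T u)
      + inner ℂ (DomInter.fst S T v) ((κ : ℂ) • DomInter.fst S T u) := rfl

variable {ν κ}

/-- Young's inequality absorbs the `l3` term into half of `ν ‖T u‖²` at the price `‖l3‖² / (2 ν)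
‖u‖²`. The bound on `γ` pays for this and for `l5`, and its `+ 1` leaves `‖u‖²` over. The factor `1
/ 3` compares the square of a sum of three norms with the sum of their squares. -/
theorem reducedForm_coercive (hν : 0 < ν) (hκ : 0 < κ)
    (hγ : ‖l5‖ + ‖l3‖ ^ 2 / (2 * ν) + 1 ≤ γ) :
    ∃ c : ℝ, 0 < c ∧ ∀ u, c * ‖u‖ ^ 2 ≤ (reducedForm S T ν γ κ l3 l5 u u).re := by
  refine ⟨min (min (ν / 2) 1) κ / 3, by positivity, fun u => ?_⟩
  rw [reducedForm_apply, DomInter.norm_eq, inner_add_right, inner_add_right]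
  simp only [Complex.add_re]
  rw [re_inner_real_smul_self, re_inner_real_smul_self, re_inner_real_smul_self]
  have h3 : -(‖DomInter.incl S T u‖ * (‖l3‖ * ‖DomInter.snd S T u‖)) ≤
      (inner ℂ (DomInter.incl S T u) (l3 (DomInter.snd S T u))).re := by
    refine neg_le_of_neg_le ((neg_le_abs _).trans ((Complex.abs_re_le_norm _).trans ?_))
    exact (norm_inner_le_norm _ _).trans (by gcongr; exact l3.le_opNorm _)
  have h5 : -(‖DomInter.incl S T u‖ * (‖l5‖ * ‖DomInter.incl S T u‖)) ≤
      (inner ℂ (DomInter.incl S T u) (l5 (DomInter.incl S T u))).re := by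
    refine neg_le_of_neg_le ((neg_le_abs _).trans ((Complex.abs_re_le_norm _).trans ?_))
    exact (norm_inner_le_norm _ _).trans (by gcongr; exact l5.le_opNorm _)
  set x := ‖DomInter.incl S T u‖
  set y := ‖DomInter.fst S T u‖
  set z := ‖DomInter.snd S T u‖
  set m := min (min (ν / 2) 1) κ
  have hm1 : m ≤ ν / 2 := (min_le_left _ _).trans (min_le_left _ _)
  have hm2 : m ≤ 1 := (min_le_left _ _).trans (min_le_right _ _)
  have hm3 : m ≤ κ := min_le_right _ _
  have hm0 : 0 ≤ m := by positivity
  have hsq : (x + y + z) ^ 2 ≤ 3 * (x ^ 2 + y ^ 2 + z ^ 2) := by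
    nlinarith [sq_nonneg (x - y), sq_nonneg (y - z), sq_nonneg (x - z)]
  have hyoung : x * (‖l3‖ * z) ≤ ν / 2 * z ^ 2 + ‖l3‖ ^ 2 / (2 * ν) * x ^ 2 := by
    have h : ν / 2 * z ^ 2 + ‖l3‖ ^ 2 / (2 * ν) * x ^ 2 - x * (‖l3‖ * z) =
        (ν * z - ‖l3‖ * x) ^ 2 / (2 * ν) := by field_simp; ring
    have : 0 ≤ (ν * z - ‖l3‖ * x) ^ 2 / (2 * ν) := by positivity
    linarith
  have hγx := mul_le_mul_of_nonneg_right hγ (sq_nonneg x)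
  calc m / 3 * (x + y + z) ^ 2 ≤ m / 3 * (3 * (x ^ 2 + y ^ 2 + z ^ 2)) := by gcongr
    _ = m * x ^ 2 + m * y ^ 2 + m * z ^ 2 := by ring
    _ ≤ 1 * x ^ 2 + κ * y ^ 2 + ν / 2 * z ^ 2 := by gcongr
    _ ≤ _ := by linarith

end ReducedForm

/-! ### Existence and uniqueness for the saddle point problem -/

section SaddlePoint

variable [CompleteSpace E]
variable {T : E →ₗ.[ℂ] F} {S : F →ₗ.[ℂ] G}

theorem kernel_orthogonal_le_kernel_adjoint (hT : Dense (T.domain : Set E))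
    (hST : ∀ x : T.domain, T x ∈ kernel S) : (kernel S)ᗮ ≤ kernel T.adjoint :=
  fun _ hy => mem_adjoint_graph_of_mem_kernel_orthogonal hT hST hy

variable [CompleteSpace F]

/-- The projection onto `(ker S)^⊥`, followed by the inclusion into `dom T*`. -/
noncomputable def projPerp (hT : Dense (T.domain : Set E))
    (hST : ∀ x : T.domain, T x ∈ kernel S) : F →L[ℂ] DomInter (0 : F →ₗ.[ℂ] ℂ) T.adjoint :=
  DomInter.ofKernel T.adjoint (kernel S)ᗮ (kernel_orthogonal_le_kernel_adjoint hT hST) ∘L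
    (kernel S)ᗮ.orthogonalProjectionOnto

/-- Subtracting the component of `x` in `ker S` does not change `S x`, and the remainder lies in
`(ker S)^⊥ ⊆ ker T*`. -/
theorem exists_toSnd_eq_projPerp (hT : Dense (T.domain : Set E)) (hSc : S.IsClosed)
    (hST : ∀ x : T.domain, T x ∈ kernel S) (x : S.domain) :
    ∃ v : DomInter S T.adjoint, DomInter.fst _ _ v = S x ∧
      DomInter.toSnd S T.adjoint v = projPerp hT hST (x : F) := by
  have : CompleteSpace (kernel S) := (isClosed_kernel hSc).completeSpace_coe
  set y : F := (projPerp hT hST (x : F)).1 with hy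
  have hy' : y = x - (kernel S).starProjection x := by
    rw [← Submodule.starProjection_orthogonal_val]; rfl
  have hgr : (y, S x) ∈ S.graph := by
    have h1 : ((x : F), S x) ∈ S.graph := S.mem_graph x
    have h2 : ((kernel S).starProjection (x : F), (0 : G)) ∈ S.graph :=
      mem_kernel.1 (Submodule.starProjection_apply_mem _ _)
    simpa [hy'] using S.graph.sub_mem h1 h2
  refine ⟨DomInter.mk S T.adjoint y (LinearPMap.mem_domain_of_mem_graph hgr)
    (projPerp hT hST (x : F)).2.2, ?_, rfl⟩
  exact ((LinearPMap.image_iff _).2 hgr).symm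

/-- Two bounded antilinear functionals on `dom T*` which agree on `dom S ∩ dom T*` are equal. -/
theorem ext_of_forall_toSnd (hT : Dense (T.domain : Set E)) (hS : Dense (S.domain : Set F))
    (hSc : S.IsClosed) (hST : ∀ x : T.domain, T x ∈ kernel S)
    {f g : DomInter (0 : F →ₗ.[ℂ] ℂ) T.adjoint →L⋆[ℂ] ℂ}
    (h : ∀ v, f (DomInter.toSnd S T.adjoint v) = g (DomInter.toSnd S T.adjoint v)) : f = g := by
  have : CompleteSpace (kernel S) := (isClosed_kernel hSc).completeSpace_coe
  -- On `(ker S)^⊥` the functionals are continuous for the norm of `F`, so agreement on projections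
  -- of the dense `dom S` suffices.
  have hperp : ∀ x : F, f (projPerp hT hST x) = g (projPerp hT hST x) := by
    have hcont := Continuous.ext_on hS (f.continuous.comp (projPerp hT hST).continuous)
      (g.continuous.comp (projPerp hT hST).continuous) fun x hx => by
        obtain ⟨v, -, hv⟩ := exists_toSnd_eq_projPerp hT hSc hST ⟨x, hx⟩
        simp only [Function.comp_apply]
        rw [← hv, h v]
    exact congrFun hcont
  ext z
  set x : F := DomInter.incl _ _ z with hx
  have hmem : ((kernel S).starProjection x, (0 : G)) ∈ S.graph :=
    mem_kernel.1 (Submodule.starProjection_apply_mem _ _)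
  have hP : DomInter.incl _ _ (z - projPerp hT hST x) = (kernel S).starProjection x := by
    have h1 : DomInter.incl _ _ (projPerp hT hST x) = x - (kernel S).starProjection x := by
      rw [← Submodule.starProjection_orthogonal_val]; rfl
    rw [map_sub, h1, ← hx, sub_sub_cancel]
  have hdom : (kernel S).starProjection x ∈ T.adjoint.domain :=
    hP ▸ DomInter.incl_mem_snd _ _ (z - projPerp hT hST x)
  -- The component in `ker S` lies in `dom S`, and in `dom T*` because `z` and its projection onto
  -- `(ker S)^⊥` do.
  have hz : z = DomInter.toSnd S T.adjoint (DomInter.mk _ _ ((kernel S).starProjection x)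
      (LinearPMap.mem_domain_of_mem_graph hmem) hdom) + projPerp hT hST x := by
    rw [← sub_eq_iff_eq_add]
    exact DomInter.incl_injective _ _ hP
  rw [hz, map_add, map_add, h, hperp]

variable {ν γ lam : ℝ} (l3 : E →L[ℂ] F) (l5 : F →L[ℂ] F)

/-- Existence for the saddle point problem. -/
theorem exists_saddlePoint [CompleteSpace G]
    (hT : Dense (T.domain : Set E)) (hS : Dense (S.domain : Set F))
    (hSc : S.IsClosed) (hST : ∀ x : T.domain, T x ∈ kernel S)
    (hν : 0 < ν) (hlam : 0 < lam) (hγ : ‖l5‖ + ‖l3‖ ^ 2 / (2 * ν) + 1 ≤ γ)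
    (f : DomInter (0 : F →ₗ.[ℂ] ℂ) T.adjoint →L⋆[ℂ] ℂ) (g : G) :
    ∃ (u : DomInter S T.adjoint) (p : DomInter (0 : G →ₗ.[ℂ] ℂ) S.adjoint),
      (lam : ℂ) • DomInter.fst _ _ u + (γ : ℂ) • DomInter.incl _ _ p = g ∧
      ∀ v : DomInter (0 : F →ₗ.[ℂ] ℂ) T.adjoint,
        inner ℂ (DomInter.snd _ _ v) ((ν : ℂ) • DomInter.snd _ _ u)
          + inner ℂ (DomInter.incl _ _ v) (l3 (DomInter.snd _ _ u) + l5 (DomInter.incl _ _ u)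
            + (γ : ℂ) • DomInter.incl _ _ u - (lam : ℂ) • DomInter.snd _ _ p) = f v := by
  have hγ0 : 0 < γ := lt_of_lt_of_le (by positivity) hγ
  have hγC : (γ : ℂ) ≠ 0 := by exact_mod_cast hγ0.ne'
  have hlamC : (lam : ℂ) ≠ 0 := by exact_mod_cast hlam.ne'
  -- Inserting `p = γ⁻¹ (g - lam S u)` into `-lam ⟨p, S v⟩` produces `(lam² / γ) ⟨S u, S v⟩` on the
  -- left and `(lam / γ) ⟨g, S v⟩` on the right.
  let κ : ℝ := lam ^ 2 / γ
  have hκ : 0 < κ := by positivity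
  obtain ⟨c, hc, hcoer⟩ := reducedForm_coercive S T.adjoint γ l3 l5 hν hκ hγ
  let rhs : DomInter S T.adjoint →L⋆[ℂ] ℂ := f.comp (DomInter.toSnd S T.adjoint) +
    pairing (ContinuousLinearMap.toSpanSingleton ℂ (((lam : ℂ) / γ) • g))
      (DomInter.fst S T.adjoint) 1
  obtain ⟨u, hu⟩ := DomInter.exists_eq_of_coercive hSc (LinearPMap.adjoint_isClosed hT)
    (reducedForm S T.adjoint ν γ κ l3 l5) hc hcoer rhs
  let R : F := l3 (DomInter.snd _ _ u) + l5 (DomInter.incl _ _ u) + (γ : ℂ) • DomInter.incl _ _ u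
  let q : G := (γ : ℂ)⁻¹ • (g - (lam : ℂ) • DomInter.fst _ _ u)
  let h₀ (w : F) : DomInter (0 : F →ₗ.[ℂ] ℂ) T.adjoint →L⋆[ℂ] ℂ :=
    pairing (ContinuousLinearMap.toSpanSingleton ℂ ((ν : ℂ) • DomInter.snd _ _ u))
      (DomInter.snd _ T.adjoint) 1
    + pairing (ContinuousLinearMap.toSpanSingleton ℂ w) (DomInter.incl _ T.adjoint) 1
  have h₀_apply (w : F) (v) : h₀ w v = inner ℂ (DomInter.snd _ _ v) ((ν : ℂ) • DomInter.snd _ _ u)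
      + inner ℂ (DomInter.incl _ _ v) w := by
    simp [h₀, pairing_apply]
  -- The reduced equation rewritten: the residual of the first equation without its pressure term is
  -- `lam ⟨q, S v⟩`, where `q` is the future pressure.
  have hq (v : DomInter S T.adjoint) : (h₀ R - f) (DomInter.toSnd S T.adjoint v) =
      (lam : ℂ) * inner ℂ (DomInter.fst _ _ v) q := by
    have h := DFunLike.congr_fun hu v
    have hr : rhs v = f (DomInter.toSnd S T.adjoint v) +
        inner ℂ (DomInter.fst _ _ v) (((lam : ℂ) / γ) • g) := by
      simp [rhs, pairing_apply]
    rw [reducedForm_apply, hr] at h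
    rw [sub_apply, h₀_apply, DomInter.incl_toSnd, DomInter.snd_toSnd]
    have h2 : (lam : ℂ) * inner ℂ (DomInter.fst _ _ v) q =
        inner ℂ (DomInter.fst _ _ v) (((lam : ℂ) / γ) • g) -
        inner ℂ (DomInter.fst _ _ v) ((κ : ℂ) • DomInter.fst _ _ u) := by
      simp only [q, κ, inner_smul_right, inner_sub_right]
      push_cast
      field_simp
    rw [h2]
    linear_combination h
  -- Taking for `v` the projection of `x` onto `(ker S)^⊥` expresses `⟨q, S x⟩` through a functional
  -- bounded in `‖x‖`.
  have hq_mem : q ∈ S.adjoint.domain := by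
    rw [LinearPMap.mem_adjoint_domain_iff]
    let k : F →L⋆[ℂ] ℂ := (h₀ R - f).comp (projPerp hT hST)
    have hk (x : S.domain) : inner ℂ q (S x) =
        (lam : ℂ)⁻¹ * (starRingEnd ℂ) (k x) := by
      obtain ⟨v, hv, hv'⟩ := exists_toSnd_eq_projPerp hT hSc hST x
      have : k x = (lam : ℂ) * inner ℂ (S x) q := by
        rw [← hv, ← hq v, hv']; rfl
      rw [this, map_mul, inner_conj_symm, Complex.conj_ofReal, inv_mul_cancel_left₀ hlamC]
    have hcont : Continuous fun x : S.domain => (lam : ℂ)⁻¹ * (starRingEnd ℂ) (k x) :=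
      continuous_const.mul (Complex.continuous_conj.comp
        (k.continuous.comp continuous_subtype_val))
    exact hcont.congr fun x => (hk x).symm
  let p : DomInter (0 : G →ₗ.[ℂ] ℂ) S.adjoint := DomInter.mk _ _ q trivial hq_mem
  refine ⟨u, p, ?_, ?_⟩
  · change (lam : ℂ) • _ + (γ : ℂ) • (γ : ℂ)⁻¹ • (g - (lam : ℂ) • DomInter.fst _ _ u) = g
    rw [smul_inv_smul₀ hγC, add_sub_cancel]
  · have key : h₀ (R - (lam : ℂ) • DomInter.snd _ _ p) = f :=
      ext_of_forall_toSnd hT hS hSc hST fun v => by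
        have hadj : inner ℂ (DomInter.incl _ _ v) (DomInter.snd _ _ p) =
            inner ℂ (DomInter.fst _ _ v) q :=
          (LinearPMap.adjoint_isFormalAdjoint hS).symm
            ⟨_, DomInter.incl_mem_fst _ _ v⟩ ⟨q, hq_mem⟩ |>.symm
        have h := hq v
        rw [sub_apply, h₀_apply, DomInter.incl_toSnd] at h
        rw [h₀_apply, inner_sub_right, DomInter.incl_toSnd,
          inner_smul_right (DomInter.incl _ _ v), hadj]
        linear_combination h
    intro v
    rw [← key, h₀_apply]

/-- Uniqueness for the saddle point problem. -/
theorem saddlePoint_unique (hS : Dense (S.domain : Set F))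
    (hν : 0 < ν) (hlam : 0 < lam) (hγ : ‖l5‖ + ‖l3‖ ^ 2 / (2 * ν) + 1 ≤ γ)
    (u : DomInter S T.adjoint) (p : DomInter (0 : G →ₗ.[ℂ] ℂ) S.adjoint)
    (hp : (lam : ℂ) • DomInter.fst _ _ u + (γ : ℂ) • DomInter.incl _ _ p = 0)
    (hu : ∀ v : DomInter (0 : F →ₗ.[ℂ] ℂ) T.adjoint,
        inner ℂ (DomInter.snd _ _ v) ((ν : ℂ) • DomInter.snd _ _ u)
          + inner ℂ (DomInter.incl _ _ v) (l3 (DomInter.snd _ _ u) + l5 (DomInter.incl _ _ u)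
            + (γ : ℂ) • DomInter.incl _ _ u - (lam : ℂ) • DomInter.snd _ _ p) = 0) :
    u = 0 ∧ p = 0 := by
  have hγ0 : 0 < γ := lt_of_lt_of_le (by positivity) hγ
  have hγC : (γ : ℂ) ≠ 0 := by exact_mod_cast hγ0.ne'
  have hκ : 0 < lam ^ 2 / γ := by positivity
  obtain ⟨c, hc, hcoer⟩ := reducedForm_coercive S T.adjoint γ l3 l5 hν hκ hγ
  have hadj : inner ℂ (DomInter.incl _ _ u) (DomInter.snd _ _ p) =
      inner ℂ (DomInter.fst _ _ u) (DomInter.incl _ _ p) :=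
    (LinearPMap.adjoint_isFormalAdjoint hS).symm
      ⟨_, DomInter.incl_mem_fst _ _ u⟩ ⟨_, DomInter.incl_mem_snd _ _ p⟩ |>.symm
  have hpu : DomInter.incl _ _ p = -((lam : ℂ) / γ) • DomInter.fst _ _ u := by
    rw [← smul_right_inj hγC, eq_neg_of_add_eq_zero_right hp, smul_smul, ← neg_smul]
    congr 1
    field_simp
  -- Test with `v = u`: the adjoint relation and `hpu` turn the pressure term into `(lam² / γ) ‖S
  -- u‖²`.
  have hzero : reducedForm S T.adjoint ν γ (lam ^ 2 / γ) l3 l5 u u = 0 := by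
    have h := hu (DomInter.toSnd S T.adjoint u)
    rw [DomInter.incl_toSnd, DomInter.snd_toSnd, inner_sub_right,
      inner_smul_right (DomInter.incl _ _ u) (DomInter.snd _ _ p), hadj, hpu] at h
    rw [reducedForm_apply, ← h]
    simp only [inner_smul_right]
    push_cast
    ring
  have hu0 : u = 0 := by
    have h := hcoer u
    rw [hzero, Complex.zero_re] at h
    have h2 : ‖u‖ ^ 2 ≤ 0 := nonpos_of_mul_nonpos_right h hc
    exact norm_eq_zero.1 (pow_eq_zero_iff two_ne_zero |>.1 (le_antisymm h2 (sq_nonneg _)))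
  refine ⟨hu0, DomInter.incl_injective _ _ ?_⟩
  rw [hpu, hu0, map_zero, map_zero, smul_zero]

end SaddlePoint

end HilbertComplex

end FluidComplex

/-! ### The weak divergence of a weak curl -/

namespace FluidComplex

section WeakDerivatives

variable {Ω : Set E3}

theorem IsTest.pd {φ : E3 → ℝ} (hφ : IsTest Ω φ) (i : Fin 3) : IsTest Ω (pd i φ) :=
  ⟨(hφ.1.fderiv_right (by simp)).clm_apply contDiff_const, hφ.2.1.fderiv_apply ℝ _,
    (tsupport_fderiv_apply_subset ℝ _).trans hφ.2.2⟩

theorem pd_comm {φ : E3 → ℝ} (hφ : ContDiff ℝ ∞ φ) (i j : Fin 3) (x : E3) :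
    pd i (pd j φ) x = pd j (pd i φ) x := by
  have hd : DifferentiableAt ℝ (fderiv ℝ φ) x :=
    ((hφ.fderiv_right (m := ∞) (by simp)).differentiable (by simp)) x
  have h (k l : Fin 3) : FluidComplex.pd k (FluidComplex.pd l φ) x =
      fderiv ℝ (fderiv ℝ φ) x (EuclideanSpace.single k 1) (EuclideanSpace.single l 1) := by
    have : FluidComplex.pd l φ = fun y => fderiv ℝ φ y (EuclideanSpace.single l 1) := rfl
    rw [FluidComplex.pd, this, fderiv_clm_apply hd (by fun_prop)]
    simp
  rw [h, h]
  exact (hφ.contDiffAt.isSymmSndFDerivAt (by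
    simpa using (WithTop.coe_le_coe.2 le_top : ((2 : ℕ∞) : WithTop ℕ∞) ≤ ∞))) _ _

theorem IsTest.integrable_mul_coord {φ : E3 → ℝ} (hφ : IsTest Ω φ) (w : L2V Ω) (i : Fin 3) :
    Integrable (fun x => (φ x : ℂ) * w x i) (volume.restrict Ω) := by
  have hw : MemLp (fun x => w x i) 2 (volume.restrict Ω) :=
    (EuclideanSpace.proj (𝕜 := ℂ) i).comp_memLp' (Lp.memLp w)
  have hφ' : MemLp (fun x => (φ x : ℂ)) 2 (volume.restrict Ω) :=
    (Complex.continuous_ofReal.comp hφ.1.continuous).memLp_of_hasCompactSupport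
      (hφ.2.1.comp_left Complex.ofReal_zero)
  exact hφ'.integrable_mul hw

/-- The weak divergence of a weak curl vanishes. -/
theorem HasWeakCurl.eq_zero_of_hasWeakDiv (hΩ : IsOpen Ω) {u c : L2V Ω} {s : L2S Ω}
    (hc : HasWeakCurl u c) (hs : HasWeakDiv c s) : s = 0 := by
  have hzero : ∀ φ : E3 → ℝ, IsTest Ω φ → ∫ x in Ω, (φ x : ℂ) * s x = 0 := by
    intro φ hφ
    have hi (i j k : Fin 3) := (((hφ.pd i).pd j).integrable_mul_coord u k)
    rw [hs φ hφ, integral_finsetSum _ fun i _ => (hφ.pd i).integrable_mul_coord c i]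
    simp_rw [fun i => hc _ (hφ.pd i) i]
    have hsub (i : Fin 3) := (hi i (i + 1) (i + 2)).sub (hi i (i + 2) (i + 1))
    simp only [Pi.sub_def] at hsub
    rw [Finset.sum_neg_distrib, neg_neg, ← integral_finsetSum _ fun i _ => hsub i]
    -- By symmetry of second derivatives the six terms cancel pointwise.
    refine integral_eq_zero_of_ae (Filter.Eventually.of_forall fun x => ?_)
    simp only [Fin.sum_univ_three, Fin.isValue]
    have e1 : (1 : Fin 3) + 1 = 2 := rfl
    have e2 : (1 : Fin 3) + 2 = 0 := rfl
    have e3 : (2 : Fin 3) + 1 = 0 := rfl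
    have e4 : (2 : Fin 3) + 2 = 1 := rfl
    rw [zero_add, zero_add, e1, e2, e3, e4, Pi.zero_apply, pd_comm hφ.1 1 0,
      pd_comm hφ.1 2 0, pd_comm hφ.1 2 1]
    ring
  have hloc : LocallyIntegrableOn (s : E3 → ℂ) Ω volume :=
    locallyIntegrableOn_of_locallyIntegrable_restrict
      ((Lp.memLp s).locallyIntegrable (by norm_num))
  have hae := hΩ.ae_eq_zero_of_integral_contDiff_smul_eq_zero hloc fun φ h1 h2 h3 => by
    have h := hzero φ ⟨h1, h2, h3⟩
    rw [setIntegral_eq_integral_of_forall_compl_eq_zero fun x hx => by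
      rw [image_eq_zero_of_notMem_tsupport fun hx' => hx (h3 hx')]; simp] at h
    simpa [Complex.real_smul] using h
  refine (Lp.eq_zero_iff_ae_eq_zero).2 ?_
  exact (ae_restrict_iff' hΩ.measurableSet).2 hae

end WeakDerivatives

end FluidComplex

/-! ### The extended primal operator -/

namespace FluidComplex

/-- The map factors through `A`, followed by a bounded operator. -/
theorem isCompactOperator_pairing {X Y H : Type*} [NormedAddCommGroup X] [NormedSpace ℂ X]
    [NormedAddCommGroup Y] [NormedSpace ℂ Y] [NormedAddCommGroup H] [InnerProductSpace ℂ H]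
    {A : X →L[ℂ] H} (hA : IsCompactOperator A) (B : Y →L[ℂ] H) :
    IsCompactOperator (pairing A B) :=
  hA.clm_comp (pairing (ContinuousLinearMap.id ℂ H) B)

theorem isInvertible_of_bijective {X Y : Type*} [NormedAddCommGroup X] [NormedSpace ℂ X]
    [CompleteSpace X] [NormedAddCommGroup Y] [NormedSpace ℂ Y] [CompleteSpace Y] (A : X →L[ℂ] Y)
    (hA : Function.Bijective A) : A.IsInvertible :=
  ⟨ContinuousLinearEquiv.ofBijective A (LinearMap.ker_eq_bot.2 hA.1)
    (LinearMap.range_eq_top.2 hA.2), ContinuousLinearEquiv.coe_ofBijective A _ _⟩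

namespace DeRham

variable {Ω : Set E3} (C : DeRham Ω)

/-- The structure only puts `d1 x` in the domain of `d2`; that `d ∘ d = 0` comes from the
distributional identity `div curl = 0`. -/
theorem d1_mem_kernel (hΩ : IsOpen Ω) (x : C.d1.domain) : C.d1 x ∈ kernel C.d2 := by
  have h0 : C.d2 ⟨C.d1 x, C.d1_mem x⟩ = 0 :=
    (C.d1_curl x).eq_zero_of_hasWeakDiv hΩ (C.d2_div ⟨C.d1 x, C.d1_mem x⟩)
  exact (LinearPMap.mem_graph_iff _).2 ⟨⟨C.d1 x, C.d1_mem x⟩, rfl, h0⟩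

theorem fst_mem_W3Perp (u : C.V2V2star) : DomInter.fst C.d2 C.dstar2 u ∈ C.W3Perp :=
  C.boundaries3.le_orthogonal_orthogonal (LinearMap.mem_range_self C.d2.toFun _)

theorem isClosed_V3starPerp : IsClosed (C.V3starPerp : Set C.V3star) :=
  C.harmonic3.isClosed_orthogonal.preimage
    (DomInter.incl (zeroOp (L2S Ω)) C.dstar3).continuous

theorem completeSpace_trial : CompleteSpace C.Trial := by
  have : CompleteSpace C.V2V2star :=
    DomInter.completeSpace C.d2_closed (LinearPMap.adjoint_isClosed C.d1_dense)
  have : CompleteSpace C.V3star :=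
    DomInter.completeSpace isClosed_zero (LinearPMap.adjoint_isClosed C.d2_dense)
  have : CompleteSpace C.V3starPerp := C.isClosed_V3starPerp.completeSpace_coe
  infer_instance

/-- The trial norms of `u` and `p` are those of the compactness property in degrees 2 and 3. -/
theorem isCompactOperator_innerOp (hC : C.CompactnessProperty) : IsCompactOperator C.innerOp := by
  have hU : IsCompactOperator C.trialU := hC.deg2.comp_clm
    (ContinuousLinearMap.fst ℂ C.V2V2star C.V3starPerp)
  have hP : IsCompactOperator C.trialP := hC.deg3.comp_clm
    (C.V3starPerp.subtypeL ∘L ContinuousLinearMap.snd ℂ C.V2V2star C.V3starPerp)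
  exact (isCompactOperator_pairing hU C.testV).add (isCompactOperator_pairing hP C.testQ)

/-- Separates the `v`-equation from the `q`-equation, in the shape used by the saddle point results.
-/
theorem Lbar_add_smul_innerOp_apply (ν lam : ℝ) (l3 l5 : L2V Ω →L[ℂ] L2V Ω) (γ : ℂ)
    (u : C.V2V2star) (p : C.V3starPerp) (v : C.V2star) (q : C.W3Perp) :
    (C.Lbar ν lam l3 l5 + γ • C.innerOp) (u, p) (v, q) =
      (inner ℂ (DomInter.snd _ _ v) ((ν : ℂ) • DomInter.snd _ _ u)
        + inner ℂ (DomInter.incl _ _ v) (l3 (DomInter.snd _ _ u) + l5 (DomInter.incl _ _ u)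
          + γ • DomInter.incl _ _ u - (lam : ℂ) • DomInter.snd _ _ p.1))
      + inner ℂ (q : L2S Ω) ((lam : ℂ) • DomInter.fst _ _ u + γ • DomInter.incl _ _ p.1) := by
  have h : (C.Lbar ν lam l3 l5 + γ • C.innerOp) (u, p) (v, q) =
      inner ℂ (DomInter.snd _ _ v) ((ν : ℂ) • DomInter.snd _ _ u)
      + inner ℂ (DomInter.incl _ _ v) (l3 (DomInter.snd _ _ u) + l5 (DomInter.incl _ _ u)
          - (lam : ℂ) • DomInter.snd _ _ p.1)
      + inner ℂ (q : L2S Ω) ((lam : ℂ) • DomInter.fst _ _ u)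
      + γ * (inner ℂ (DomInter.incl _ _ v) (DomInter.incl _ _ u)
        + inner ℂ (q : L2S Ω) (DomInter.incl _ _ p.1)) := rfl
  rw [h, add_sub_right_comm (l3 (DomInter.snd _ _ u) + l5 (DomInter.incl _ _ u)),
    inner_add_right (DomInter.incl _ _ v) _ (γ • DomInter.incl _ _ u),
    inner_add_right (q : L2S Ω), inner_smul_right _ (DomInter.incl _ _ u) γ,
    inner_smul_right _ (DomInter.incl _ _ p.1) γ]
  ring

variable {ν lam γ : ℝ} (l3 l5 : L2V Ω →L[ℂ] L2V Ω)

theorem injective_Lbar_add_smul_innerOp (hν : 0 < ν) (hlam : 0 < lam)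
    (hγ : ‖l5‖ + ‖l3‖ ^ 2 / (2 * ν) + 1 ≤ γ) :
    Function.Injective (C.Lbar ν lam l3 l5 + (γ : ℂ) • C.innerOp) := by
  rw [injective_iff_map_eq_zero]
  rintro ⟨u, p⟩ h
  have h' (v : C.V2star) (q : C.W3Perp) :=
    (C.Lbar_add_smul_innerOp_apply ν lam l3 l5 γ u p v q).symm.trans
      (DFunLike.congr_fun h (v, q))
  -- The left side of the `q`-equation is itself an admissible `q`; testing with it makes it vanish.
  have hmem : (lam : ℂ) • DomInter.fst C.d2 C.dstar2 u + (γ : ℂ) • DomInter.incl _ _ p.1 ∈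
      C.W3Perp :=
    C.W3Perp.add_mem (C.W3Perp.smul_mem _ (C.fst_mem_W3Perp u)) (C.W3Perp.smul_mem _ p.2)
  have hp : (lam : ℂ) • DomInter.fst C.d2 C.dstar2 u + (γ : ℂ) • DomInter.incl _ _ p.1 = 0 := by
    have h0 := h' 0 ⟨_, hmem⟩
    rw [map_zero, map_zero, inner_zero_left, inner_zero_left, zero_add, zero_add] at h0
    exact inner_self_eq_zero.1 h0
  obtain ⟨rfl, hp0⟩ := saddlePoint_unique l3 l5 C.d2_dense hν hlam hγ u p.1 hp fun v => by
    have h0 := h' v 0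
    rwa [hp, inner_zero_right, add_zero] at h0
  exact Prod.ext rfl (Subtype.ext hp0)

theorem surjective_Lbar_add_smul_innerOp (hΩ : IsOpen Ω) (hν : 0 < ν) (hlam : 0 < lam)
    (hγ : ‖l5‖ + ‖l3‖ ^ 2 / (2 * ν) + 1 ≤ γ) :
    Function.Surjective (C.Lbar ν lam l3 l5 + (γ : ℂ) • C.innerOp) := by
  intro φ
  have hγ0 : 0 < γ := lt_of_lt_of_le (by positivity) hγ
  have hγC : (γ : ℂ) ≠ 0 := by exact_mod_cast hγ0.ne'
  -- Riesz representation of the antilinear functional `q ↦ φ (0, q)`, as Lax–Milgram for the inner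
  -- product.
  obtain ⟨g, hg⟩ := exists_eq_of_coercive_sesq (pairing (ContinuousLinearMap.id ℂ C.W3Perp)
      (ContinuousLinearMap.id ℂ C.W3Perp)) one_pos
    (fun u => by
      have h := re_inner_real_smul_self 1 u
      rw [Complex.ofReal_one, one_smul] at h
      exact h.ge)
    (φ.comp (ContinuousLinearMap.inr ℂ C.V2star C.W3Perp))
  obtain ⟨u, p, hp, hu⟩ := exists_saddlePoint l3 l5 C.d1_dense C.d2_dense C.d2_closed
    (C.d1_mem_kernel hΩ) hν hlam hγ (φ.comp (ContinuousLinearMap.inl ℂ C.V2star C.W3Perp))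
    (g : L2S Ω)
  -- `γ p = g - lam d u`, and both terms on the right are orthogonal to the harmonic forms.
  have hpmem : p ∈ C.V3starPerp := by
    have h1 : (γ : ℂ) • DomInter.incl _ _ p ∈ C.W3Perp := by
      rw [eq_sub_of_add_eq' hp]
      exact C.W3Perp.sub_mem g.2 (C.W3Perp.smul_mem _ (C.fst_mem_W3Perp u))
    exact (C.W3Perp.smul_mem_iff hγC).1 h1
  refine ⟨(u, ⟨p, hpmem⟩), ContinuousLinearMap.ext ?_⟩
  rintro ⟨v, q⟩
  have hq : inner ℂ (q : L2S Ω) (g : L2S Ω) = φ (0, q) := DFunLike.congr_fun hg q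
  refine (C.Lbar_add_smul_innerOp_apply ν lam l3 l5 γ u ⟨p, hpmem⟩ v q).trans ?_
  refine (congrArg₂ (· + ·) (hu v) ((congrArg (inner ℂ (q : L2S Ω)) hp).trans hq)).trans ?_
  change φ (v, 0) + φ (0, q) = φ (v, q)
  rw [← map_add, Prod.mk_add_mk, add_zero, zero_add]

theorem isInvertible_Lbar_add_smul_innerOp (hΩ : IsOpen Ω) (hν : 0 < ν) (hlam : 0 < lam)
    (hγ : ‖l5‖ + ‖l3‖ ^ 2 / (2 * ν) + 1 ≤ γ) :
    (C.Lbar ν lam l3 l5 + (γ : ℂ) • C.innerOp).IsInvertible := by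
  have := C.completeSpace_trial
  exact isInvertible_of_bijective (X := C.Trial) (Y := C.TestDual)
    (C.Lbar ν lam l3 l5 + (γ : ℂ) • C.innerOp)
    ⟨C.injective_Lbar_add_smul_innerOp l3 l5 hν hlam hγ,
      C.surjective_Lbar_add_smul_innerOp l3 l5 hΩ hν hlam hγ⟩

end DeRham
end FluidComplex

theorem mainTheorem4 (Ω : Set FluidComplex.E3) (hΩ_open : IsOpen Ω) (hΩ_conn : IsConnected Ω)
    (hΩ_bdd : Bornology.IsBounded Ω)
    (C : FluidComplex.DeRham Ω) (hC : C.CompactnessProperty)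
    (ν : ℝ) (hν : 0 < ν) (lam : ℝ) (hlam : 0 < lam)
    (l3 l5 : FluidComplex.L2V Ω →L[ℂ] FluidComplex.L2V Ω) :
    {γ : ℂ | ¬ (C.Lbar ν lam l3 l5 + γ • C.innerOp).IsInvertible}.Countable := by
  have := C.completeSpace_trial
  -- `le_rfl` fixes `γ₀` as the coercivity threshold `‖l5‖ + ‖l3‖² / (2 ν) + 1`.
  have h := C.isInvertible_Lbar_add_smul_innerOp l3 l5 hΩ_open hν hlam le_rfl
  have hK := C.isCompactOperator_innerOp hC
  generalize C.Lbar ν lam l3 l5 = A at h ⊢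
  generalize C.innerOp = K at h hK ⊢
  exact IsCompactOperator.countable_setOf_not_isInvertible_add_smul (𝕜 := ℂ) (X := C.Trial)
    (Y := C.TestDual) (A := A) (K := K) hK h
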